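/- Let $\mathbb K$ be a field of characteristic $0$, and let $q$ be one of the symbols $\theta$ (with $\theta\in\mathbb K$ an arbitrary scalar), $\mathrm r$, $\ell$. A commutative $\mathbf R$-algebra (of kind $q$) is a commutative unital $\mathbb K$-algebra $B$ with a $\mathbb K$-linear map $X:B\to B$ such that for all $x,y\in B$ $$X(x)X(y)=X\bigl(X(x)y+xX(y)\bigr)+\begin{cases}X(\theta xy)& q=\theta\ \text{(Rota--Baxter algebra of weight }\theta),\\ -X^2(xy)& q=\mathrm r\ \text{(Nijenhuis algebra)},\\ -X(xX(1)y)& q=\ell\ \text{(}TD\text{-algebra)}.\end{cases}$$ An $\mathbf R$-algebra morphism is a unital algebra morphism commuting with the operators. The ground field $\mathbb K$ is an $\mathbf R$-algebra with operator $-\theta\,\mathrm{id}$ if $q=\theta$, and $\mathrm{id}$ if $q\in\{\mathrm r,\ell\}$; if $(B,P)$ is an $\mathbf R$-algebra, so is $(B\otimes B,P\otimes\mathrm{id})$. A right $\mathbf R$-bialgebra is an $\mathbf R$-algebra $(B,P)$ with $\mathbf R$-algebra morphisms $\Delta:B\to B\otimes B$ and $\varepsilon:B\to\mathbb K$ such that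 $\Delta$ is coassociative and $(\mathrm{id}\otimes\varepsilon)\Delta=\mathrm{id}_B$. For a commutative unital $\mathbb K$-algebra $A$ let $\bullet^q$ be the bilinear product on $T(A)=\bigoplus_{n\ge0}A^{\otimes n}$ with unit $1_{\mathbb K}\in A^{\otimes 0}$ and, for $a,b\in A$, $U,V\in T(A)$, $$(a\otimes U)\bullet^q(b\otimes V)=a\otimes\bigl(U\bullet^q(b\otimes V)\bigr)+b\otimes\bigl((a\otimes U)\bullet^q V\bigr)+\begin{cases}\theta\,ab\otimes(U\bullet^qV)&q=\theta,\\-1_A\otimes ab\otimes(U\bullet^qV)&q=\mathrm r,\\-ab\otimes1_A\otimes(U\bullet^qV)&q=\ell.\end{cases}$$ Put $T^+(A)=A\otimes T(A)$ with the product $(a\otimes U)\,\bar\bullet^q\,(b\otimes V)=ab\otimes(U\bullet^qV)$, the operator $P_A(a\otimes U)=1_A\otimes(a\otimes U)$, and $i_A:A\to T^+(A)$, $a\mapsto a\otimes1_{\mathbb K}$. **Theorem.** Let $(H,m_H,\delta,\epsilon)$ be a commutative bialgebra over $\mathbb K$. Then $(T^+(H),\bar\bullet^q,P_H)$, with the injective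 unital algebra morphism $i_H$, is the free commutative $\mathbf R$-algebra over the algebra $H$: for every commutative $\mathbf R$-algebra $(B,X)$ and every unital algebra morphism $\phi:H\to B$ there is a unique $\mathbf R$-algebra morphism $\tilde\phi:T^+(H)\to B$ with $\tilde\phi\circ i_H=\phi$. Moreover, the unique $\mathbf R$-algebra morphism $\Delta:T^+(H)\to T^+(H)\otimes T^+(H)$ with $\Delta\circ i_H=(i_H\otimes i_H)\circ\delta$ and the unique $\mathbf R$-algebra morphism $\varepsilon:T^+(H)\to\mathbb K$ with $\varepsilon\circ i_H=\epsilon$ make $(T^+(H),\bar\bullet^q,P_H)$ a right $\mathbf R$-bialgebra. -/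

import Mathlib

open scoped TensorProduct

universe w u v

namespace RAlg

/-- The index `q ∈ {θ, r, ℓ}`: it selects one of the generalized shuffle products and, at the
same time, one of the categories of commutative unital R-algebras: Rota--Baxter algebras of
scalar weight `θ`, Nijenhuis algebras (`right`), and `TD`-algebras (`left`). -/
inductive Kind (K : Type*) where
  | theta (θ : K) : Kind K
  | right : Kind K
  | left : Kind K

section Operators

variable {K : Type*} [CommRing K]

/-- The operator identity of an R-algebra of kind `q`: the Rota--Baxter relation of scalar
weight `θ`, the Nijenhuis relation, or the `TD`-relation. -/
def IsROperator (q : Kind K) {B : Type*} [CommRing B] [Algebra K B] (X : B →ₗ[K] B) : Prop :=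
  match q with
  | .theta θ => ∀ x y : B, X x * X y = X (X x * y + x * X y) + X (θ • (x * y))
  | .right => ∀ x y : B, X x * X y = X (X x * y + x * X y) - X (X (x * y))
  | .left => ∀ x y : B, X x * X y = X (X x * y + x * X y) - X (x * X 1 * y)

/-- The operator that makes the ground ring an R-algebra of kind `q`: `-θ id` for weight `θ`,
and the identity in the Nijenhuis and `TD` cases. -/
def groundOp : Kind K → (K →ₗ[K] K)
  | .theta θ => -(θ • LinearMap.id)
  | .right => LinearMap.id
  | .left => LinearMap.id

/-- A unital algebra morphism `(B, X) → (C, Y)` that commutes with the operators. -/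
def IsRHom {B C : Type*} [CommRing B] [Algebra K B] [CommRing C] [Algebra K C]
    (X : B →ₗ[K] B) (Y : C →ₗ[K] C) (f : B →ₐ[K] C) : Prop :=
  ∀ x, f (X x) = Y (f x)

/-- The operator `P ⊗ id` on `B ⊗ B`. -/
noncomputable def tensorOp {B : Type*} [CommRing B] [Algebra K B] (P : B →ₗ[K] B) :
    B ⊗[K] B →ₗ[K] B ⊗[K] B :=
  TensorProduct.map P LinearMap.id

/-- `(F, P)` with `i : A → F` is the free commutative R-algebra of kind `q` over the commutative
algebra `A`, tested against R-algebras in the universe `uB`. -/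
structure IsFree.{uB, uK, uA, uF} {K : Type uK} [CommRing K] (q : Kind K)
    {A : Type uA} [CommRing A] [Algebra K A] {F : Type uF} [CommRing F] [Algebra K F]
    (P : F →ₗ[K] F) (i : A →ₐ[K] F) : Prop where
  isROperator : IsROperator q P
  injective : Function.Injective i
  existsUnique_lift : ∀ (B : Type uB) [CommRing B] [Algebra K B] (X : B →ₗ[K] B),
    IsROperator q X → ∀ φ : A →ₐ[K] B, ∃! f : F →ₐ[K] B, IsRHom P X f ∧ f.comp i = φ

/-- `(B, P)` with coproduct `Δ` and counit `ε` is a (commutative) right R-bialgebra of kind `q`: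
`B ⊗ B` carries the operator `P ⊗ id`, the ground ring the operator `groundOp q`. -/
structure IsRightRBialgebra (q : Kind K) {B : Type*} [CommRing B] [Algebra K B]
    (P : B →ₗ[K] B) (Δ : B →ₐ[K] B ⊗[K] B) (ε : B →ₐ[K] K) : Prop where
  isROperator : IsROperator q P
  isROperator_tensor : IsROperator q (tensorOp P)
  isROperator_ground : IsROperator q (groundOp q)
  isRHom_coproduct : IsRHom P (tensorOp P) Δ
  isRHom_counit : IsRHom P (groundOp q) ε
  coassoc : (TensorProduct.assoc K B B B).toLinearMap ∘ₗ
      TensorProduct.map Δ.toLinearMap LinearMap.id ∘ₗ Δ.toLinearMap =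
    TensorProduct.map LinearMap.id Δ.toLinearMap ∘ₗ Δ.toLinearMap
  right_counit : (TensorProduct.rid K B).toLinearMap ∘ₗ
      TensorProduct.map LinearMap.id ε.toLinearMap ∘ₗ Δ.toLinearMap = LinearMap.id

end Operators

section Product

variable (K : Type*) [CommRing K] (q : Kind K) (A : Type*) [CommRing A] [Algebra K A]

/-- Prepending a letter to a word, `(a, U) ↦ a ⊗ U`. -/
def cons : A →ₗ[K] TensorAlgebra K A →ₗ[K] TensorAlgebra K A :=
  (LinearMap.mul K (TensorAlgebra K A)).comp (TensorAlgebra.ι K)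

variable {K A}

/-- The contraction of two letters:
`θ [a;b]`, respectively `-1 ⊗ [a;b]`, respectively `-[a;b] ⊗ 1`. -/
def contr (q : Kind K) (a b : A) : TensorAlgebra K A :=
  match q with
  | .theta θ => θ • TensorAlgebra.ι K (a * b)
  | .right => -(TensorAlgebra.ι K 1 * TensorAlgebra.ι K (a * b))
  | .left => -(TensorAlgebra.ι K (a * b) * TensorAlgebra.ι K 1)

theorem contr_add_left (a a' b : A) : contr q (a + a') b = contr q a b + contr q a' b := by
  cases q <;> simp [contr, add_mul, mul_add, add_comm]

theorem contr_add_right (a b b' : A) : contr q a (b + b') = contr q a b + contr q a b' := by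
  cases q <;> simp [contr, add_mul, mul_add, add_comm]

theorem contr_smul_left (k : K) (a b : A) : contr q (k • a) b = k • contr q a b := by
  cases q <;> simp [contr, smul_comm k]

theorem contr_smul_right (k : K) (a b : A) : contr q a (k • b) = k • contr q a b := by
  cases q <;> simp [contr, smul_comm k]

theorem contr_comm (a b : A) : contr q a b = contr q b a := by
  cases q <;> simp [contr, mul_comm a b]

/-- Auxiliary: `(a, L) ↦ a ⊗ L (b ⊗ V) + contr a b ⊗ L V`. -/
def stepHead (b : A) (V : TensorAlgebra K A) :
    A →ₗ[K] Module.End K (TensorAlgebra K A) →ₗ[K] TensorAlgebra K A :=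
  LinearMap.mk₂ K (fun a L => cons K A a (L (cons K A b V)) + contr q a b * L V)
    (by intro a a' L; simp [contr_add_left, add_mul]; abel)
    (by intro k a L; simp [contr_smul_left])
    (by intro a L L'; simp [mul_add]; abel)
    (by intro k a L; simp)

/-- Auxiliary: one step of the recursion over the second word. The first component of the state
is `(a, L) ↦ (a ⊗ U) • V`, where `L` stands for `U • -`; the second one is `V` itself. -/
def stepRight : A →ₗ[K] Module.End K
    ((A →ₗ[K] Module.End K (TensorAlgebra K A) →ₗ[K] TensorAlgebra K A) × TensorAlgebra K A) :=
  LinearMap.mk₂ K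
    (fun b p => (stepHead q b p.2 + p.1.compr₂ (cons K A b), cons K A b p.2))
    (by intro b b' p
        refine Prod.ext ?_ (by simp)
        ext a L
        simp [stepHead, contr_add_right, add_mul]; abel)
    (by intro k b p
        refine Prod.ext ?_ (by simp)
        ext a L
        simp [stepHead, contr_smul_right])
    (by intro b p p'
        refine Prod.ext ?_ (by simp)
        ext a L
        simp [stepHead, mul_add]; abel)
    (by intro k b p
        refine Prod.ext ?_ (by simp)
        ext a L
        simp [stepHead])

/-- Auxiliary: the state at the empty second word. -/
def stepStart : (A →ₗ[K] Module.End K (TensorAlgebra K A) →ₗ[K] TensorAlgebra K A) ×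
    TensorAlgebra K A :=
  (LinearMap.mk₂ K (fun a L => cons K A a (L 1)) (by intros; simp) (by intros; simp)
    (by intros; simp) (by intros; simp), 1)

/-- Auxiliary: the recursion over the second word. -/
def foldRight : TensorAlgebra K A →ₗ[K]
    (A →ₗ[K] Module.End K (TensorAlgebra K A) →ₗ[K] TensorAlgebra K A) × TensorAlgebra K A :=
  (LinearMap.applyₗ (stepStart (K := K) (A := A))).comp
    (TensorAlgebra.lift K (stepRight (A := A) q)).toLinearMap

/-- Auxiliary: one step of the recursion over the first word, `(U • -) ↦ ((a ⊗ U) • -)`. -/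
def stepLeft : A →ₗ[K] Module.End K (Module.End K (TensorAlgebra K A)) :=
  LinearMap.mk₂ K
    (fun a L => ((LinearMap.applyₗ L).comp (LinearMap.applyₗ a)).comp
      ((LinearMap.fst K _ _).comp (foldRight q)))
    (by intros; ext; simp) (by intros; ext; simp)
    (by intros; ext; simp) (by intros; ext; simp)

/-- The generalized shuffle product `•^q` on `T(A)`. It is the bilinear map determined by the
recursion in `shuffle_one_left`, `shuffle_one_right` and `shuffle_cons_cons` below. -/
def shuffle : TensorAlgebra K A →ₗ[K] TensorAlgebra K A →ₗ[K] TensorAlgebra K A :=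
  (LinearMap.applyₗ (LinearMap.id : Module.End K (TensorAlgebra K A))).comp
    (TensorAlgebra.lift K (stepLeft (A := A) q)).toLinearMap

theorem shuffle_one_left (V : TensorAlgebra K A) : shuffle q 1 V = V := by
  simp [shuffle]

theorem foldRight_one : foldRight (K := K) (A := A) q 1 = stepStart := by
  simp [foldRight]

theorem foldRight_cons (b : A) (V : TensorAlgebra K A) :
    foldRight q (cons K A b V) = stepRight q b (foldRight q V) := by
  simp [foldRight, cons]

theorem shuffle_cons (a : A) (U : TensorAlgebra K A) (V : TensorAlgebra K A) :
    shuffle q (cons K A a U) V = (foldRight q V).1 a (shuffle q U) := by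
  simp [shuffle, cons, stepLeft]

/-- Induction on words. -/
theorem word_induction {p : TensorAlgebra K A → Prop} (one : p 1)
    (cons : ∀ a U, p U → p (cons K A a U)) (add : ∀ U V, p U → p V → p (U + V))
    (smul : ∀ (k : K) U, p U → p (k • U)) (U : TensorAlgebra K A) : p U := by
  suffices h : ∀ V, p V → p (U * V) by simpa using h 1 one
  induction U using TensorAlgebra.induction with
  | algebraMap r => intro V hV; rw [← Algebra.smul_def]; exact smul r V hV
  | ι a => intro V hV; exact cons a V hV
  | mul U U' h h' => intro V hV; rw [mul_assoc]; exact h _ (h' _ hV)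
  | add U U' h h' => intro V hV; rw [add_mul]; exact add _ _ (h V hV) (h' V hV)

theorem foldRight_snd (V : TensorAlgebra K A) : (foldRight q V).2 = V := by
  induction V using word_induction with
  | one => simp [foldRight_one, stepStart]
  | cons a U h => rw [foldRight_cons]; simp [stepRight, h]
  | add U V h h' => simp [h, h']
  | smul k U h => simp [h]

theorem shuffle_one_right (U : TensorAlgebra K A) : shuffle q U 1 = U := by
  induction U using word_induction with
  | one => simp [shuffle_one_left]
  | cons a U h => rw [shuffle_cons, foldRight_one]; simp [stepStart, h]
  | add U V h h' => simp [h, h']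
  | smul k U h => simp [h]

/-- The recursive definition of the product:
`a ⊗ U • b ⊗ V = a ⊗ (U • b ⊗ V) + b ⊗ (a ⊗ U • V) + contr a b ⊗ (U • V)`. -/
theorem shuffle_cons_cons (a b : A) (U V : TensorAlgebra K A) :
    shuffle q (cons K A a U) (cons K A b V) =
      cons K A a (shuffle q U (cons K A b V)) + cons K A b (shuffle q (cons K A a U) V) +
        contr q a b * shuffle q U V := by
  rw [shuffle_cons, foldRight_cons, shuffle_cons]
  simp [stepRight, stepHead, foldRight_snd]
  abel

theorem shuffle_comm (U V : TensorAlgebra K A) : shuffle q U V = shuffle q V U := by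
  induction U using word_induction generalizing V with
  | one => rw [shuffle_one_left, shuffle_one_right]
  | cons a U hU =>
    induction V using word_induction with
    | one => rw [shuffle_one_left, shuffle_one_right]
    | cons b V hV =>
      rw [shuffle_cons_cons, shuffle_cons_cons, hU, hV, hU V, contr_comm q a b]
      abel
    | add V V' h h' => simp [h, h']
    | smul k V h => simp [h]
  | add U U' h h' => simp [h, h']
  | smul k U h => simp [h]

/-- The double contraction of three letters. -/
def contr₃ (q : Kind K) (a b c : A) : TensorAlgebra K A :=
  match q with
  | .theta θ => θ • θ • TensorAlgebra.ι K (a * b * c)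
  | .right =>
    TensorAlgebra.ι K 1 * (TensorAlgebra.ι K 1 * TensorAlgebra.ι K (a * b * c))
  | .left =>
    TensorAlgebra.ι K (a * b * c) * (TensorAlgebra.ι K 1 * TensorAlgebra.ι K 1)

theorem shuffle_left_one_cons (X Z : TensorAlgebra K A) :
    shuffle .left (cons K A 1 X) Z = cons K A 1 (shuffle .left X Z) := by
  induction Z using word_induction generalizing X with
  | one => simp [shuffle_one_right]
  | cons c W h =>
    rw [shuffle_cons_cons, h]
    simp [contr, cons, mul_assoc]
  | add V V' h h' => simp [h, h']
  | smul k V h => simp [h]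

theorem shuffle_contr (a b c : A) (X W : TensorAlgebra K A) :
    shuffle q (contr q a b * X) (cons K A c W) =
      contr q a b * shuffle q X (cons K A c W) + cons K A c (shuffle q (contr q a b * X) W) +
        contr₃ q a b c * shuffle q X W := by
  cases q with
  | theta θ =>
    have h := shuffle_cons_cons (.theta θ) (a * b) c X W
    have e : contr (.theta θ) a b * X = θ • cons K A (a * b) X := by simp [contr, cons]
    rw [e, map_smul, LinearMap.smul_apply, h]
    simp [contr, contr₃, cons]
  | right =>
    have e : contr .right a b * X = -cons K A 1 (cons K A (a * b) X) := by
      simp [contr, cons, mul_assoc]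
    rw [e, map_neg, LinearMap.neg_apply, shuffle_cons_cons, shuffle_cons_cons]
    simp [contr, contr₃, cons, mul_assoc, mul_add]
    abel
  | left =>
    have e : contr .left a b * X = -cons K A (a * b) (cons K A 1 X) := by
      simp [contr, cons, mul_assoc]
    rw [e, map_neg, LinearMap.neg_apply, shuffle_cons_cons, shuffle_left_one_cons,
      shuffle_left_one_cons]
    simp [contr, contr₃, cons, mul_assoc]
    abel

theorem contr₃_rotate (a b c : A) : contr₃ q a b c = contr₃ q b c a := by
  cases q <;> simp [contr₃, mul_comm, mul_left_comm]

theorem shuffle_assoc (U V W : TensorAlgebra K A) :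
    shuffle q (shuffle q U V) W = shuffle q U (shuffle q V W) := by
  induction U using word_induction generalizing V W with
  | one => simp [shuffle_one_left]
  | cons a U hU =>
    induction V using word_induction generalizing W with
    | one => simp [shuffle_one_left, shuffle_one_right]
    | cons b V hV =>
      induction W using word_induction with
      | one => simp [shuffle_one_right]
      | cons c W hW =>
        have l : shuffle q (shuffle q (cons K A a U) (cons K A b V)) (cons K A c W) =
            cons K A a (shuffle q (shuffle q U (cons K A b V)) (cons K A c W)) +
            cons K A b (shuffle q (shuffle q (cons K A a U) V) (cons K A c W)) +
            cons K A c (shuffle q (shuffle q (cons K A a U) (cons K A b V)) W) +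
            contr q a b * shuffle q (shuffle q U V) (cons K A c W) +
            contr q a c * shuffle q (shuffle q U (cons K A b V)) W +
            contr q b c * shuffle q (shuffle q (cons K A a U) V) W +
            contr₃ q a b c * shuffle q (shuffle q U V) W := by
          rw [shuffle_cons_cons q a b U V]
          generalize shuffle q U (cons K A b V) = X
          generalize shuffle q (cons K A a U) V = Y
          generalize shuffle q U V = Z
          simp only [map_add, LinearMap.add_apply]
          rw [shuffle_cons_cons q a c X W, shuffle_cons_cons q b c Y W, shuffle_contr]
          abel
        have r : shuffle q (cons K A a U) (shuffle q (cons K A b V) (cons K A c W)) =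
            cons K A a (shuffle q U (shuffle q (cons K A b V) (cons K A c W))) +
            cons K A b (shuffle q (cons K A a U) (shuffle q V (cons K A c W))) +
            cons K A c (shuffle q (cons K A a U) (shuffle q (cons K A b V) W)) +
            contr q a b * shuffle q U (shuffle q V (cons K A c W)) +
            contr q a c * shuffle q U (shuffle q (cons K A b V) W) +
            contr q b c * shuffle q (cons K A a U) (shuffle q V W) +
            contr₃ q a b c * shuffle q U (shuffle q V W) := by
          rw [shuffle_cons_cons q b c V W]
          generalize shuffle q V (cons K A c W) = X
          generalize shuffle q (cons K A b V) W = Y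
          generalize shuffle q V W = Z
          simp only [map_add]
          rw [shuffle_cons_cons q a b U X, shuffle_cons_cons q a c U Y,
            shuffle_comm q (cons K A a U) (contr q b c * Z), shuffle_contr,
            shuffle_comm q (contr q b c * Z) U, shuffle_comm q Z U,
            shuffle_comm q Z (cons K A a U), ← contr₃_rotate]
          abel
        rw [l, r, hW, hU, hU, hU, hU, hV, hV]
      | add V V' h h' => simp [h, h']
      | smul k V h => simp [h]
    | add V V' h h' => simp [h, h']
    | smul k V h => simp [h]
  | add V V' h h' => simp [h, h']
  | smul k V h => simp [h]

end Product

section Algebra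

variable (K : Type*) [CommRing K] (q : Kind K) (A : Type*) [CommRing A] [Algebra K A]

/-- The module `T(A)`, to be equipped with the product `•^q` instead of concatenation. -/
def Sh (K : Type*) [CommRing K] (_q : Kind K) (A : Type*) [CommRing A] [Algebra K A] : Type _ :=
  TensorAlgebra K A

noncomputable instance : AddCommGroup (Sh K q A) :=
  inferInstanceAs (AddCommGroup (TensorAlgebra K A))

noncomputable instance : Module K (Sh K q A) := inferInstanceAs (Module K (TensorAlgebra K A))

/-- The identity map `T(A) → Sh K q A`. -/
def Sh.of : TensorAlgebra K A ≃ₗ[K] Sh K q A := LinearEquiv.refl K (TensorAlgebra K A)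

noncomputable instance : One (Sh K q A) := ⟨Sh.of K q A 1⟩

noncomputable instance : Mul (Sh K q A) :=
  ⟨fun U V => Sh.of K q A (shuffle q ((Sh.of K q A).symm U) ((Sh.of K q A).symm V))⟩

theorem Sh.mul_def (U V : Sh K q A) :
    U * V = Sh.of K q A (shuffle q ((Sh.of K q A).symm U) ((Sh.of K q A).symm V)) := rfl

theorem Sh.one_def : (1 : Sh K q A) = Sh.of K q A 1 := rfl

/-- The commutative algebra `(T(A), •^q, 1_K)`. -/
noncomputable instance : CommRing (Sh K q A) :=
  { (inferInstance : AddCommGroup (Sh K q A)) with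
    mul := (· * ·)
    one := 1
    left_distrib := fun U V W => by simp [Sh.mul_def]
    right_distrib := fun U V W => by simp [Sh.mul_def]
    zero_mul := fun U => by simp [Sh.mul_def]
    mul_zero := fun U => by simp [Sh.mul_def]
    mul_assoc := fun U V W => by simp [Sh.mul_def, shuffle_assoc]
    one_mul := fun U => by simp [Sh.mul_def, Sh.one_def, shuffle_one_left]
    mul_one := fun U => by simp [Sh.mul_def, Sh.one_def, shuffle_one_right]
    mul_comm := fun U V => by rw [Sh.mul_def, Sh.mul_def, shuffle_comm] }

noncomputable instance : Algebra K (Sh K q A) :=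
  Algebra.ofModule (fun k U V => by simp [Sh.mul_def]) (fun k U V => by simp [Sh.mul_def])

/-- `T⁺(A) = A ⊗ T(A)` with the product `(a ⊗ U)(b ⊗ V) = [a;b] ⊗ (U •^q V)`, that is, the
tensor product of the algebras `A` and `(T(A), •^q)`. -/
abbrev TPlus : Type _ := A ⊗[K] Sh K q A

/-- The inclusion `a ↦ a ⊗ 1_K`. -/
noncomputable def incl : A →ₐ[K] TPlus K q A := Algebra.TensorProduct.includeLeft

/-- The right-shift map `P_A : a ⊗ U ↦ 1_A ⊗ (a ⊗ U)`. -/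
noncomputable def rightShift : TPlus K q A →ₗ[K] TPlus K q A :=
  (TensorProduct.mk K A (Sh K q A) 1).comp
    (TensorProduct.lift (((cons K A).compr₂ (Sh.of K q A).toLinearMap).compl₂
      (Sh.of K q A).symm.toLinearMap))

theorem TPlus.tmul_mul_tmul (a b : A) (U V : TensorAlgebra K A) :
    ((a ⊗ₜ Sh.of K q A U) * (b ⊗ₜ Sh.of K q A V) : TPlus K q A) =
      (a * b) ⊗ₜ Sh.of K q A (shuffle q U V) := by
  rw [Algebra.TensorProduct.tmul_mul_tmul]; rfl

theorem rightShift_tmul (a : A) (U : TensorAlgebra K A) :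
    rightShift K q A (a ⊗ₜ Sh.of K q A U) = 1 ⊗ₜ Sh.of K q A (cons K A a U) := by
  simp [rightShift]

end Algebra

end RAlg

/-! Freeness: in `T⁺(A)` one has `a ⊗ U = i(a) · (1 ⊗ U)` and `1 ⊗ (a ⊗ U) = P(a ⊗ U)`, so an
R-algebra morphism extending `φ` must send `a₀ ⊗ a₁ ⊗ ⋯ ⊗ aₙ` to `φ(a₀) X(φ(a₁) X(⋯ X(φ(aₙ))))`.
This gives uniqueness (`IsRHom.ext_incl`). For existence, let `w` be the map `a ⊗ U ↦ X(φ(a) w(U))`,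
`1 ↦ 1`. The recursion for `•^q` is the operator identity read letter by letter, so `w` is
multiplicative (`wordLift_shuffle`). Only the `TD` case needs more: the contraction yields `X(w(U))`
where the identity has `X(1) w(U)`, and these agree on values of words (`op_one_mul_wordLift`).

Bialgebra: `Δ` and `ε` are lifts, and the two axioms compare R-algebra morphisms out of `T⁺(H)`. By
uniqueness they need checking on `H` only, where they are the axioms of `H`. Since the operator on
tensor powers sits on the leftmost factor, `id ⊗ ε` respects it; this is why the counit is
one-sided. -/

namespace RAlg

/-! ### R-operators and R-morphisms on tensor products -/

section Operators

variable {K : Type*} [CommRing K] {q : Kind K} {B C D : Type*} [CommRing B] [Algebra K B]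
  [CommRing C] [Algebra K C] [CommRing D] [Algebra K D]

theorem isROperator_groundOp (q : Kind K) : IsROperator q (groundOp q) := by
  cases q with
  | theta θ => intro x y; simp [groundOp]; ring
  | right => intro x y; simp [groundOp]
  | left => intro x y; simp [groundOp]

/-- `P ⊗ id` is an R-operator on `B ⊗ C` whenever `P` is one on `B`. -/
theorem IsROperator.map_id {P : B →ₗ[K] B} (hP : IsROperator q P) :
    IsROperator q (TensorProduct.map P (LinearMap.id : C →ₗ[K] C)) := by
  cases q with
  | theta θ =>
    intro x y
    induction x with
    | zero => simp
    | add x x' hx hx' => simp only [map_add, add_mul, hx, hx', smul_add]; abel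
    | tmul b c =>
      induction y with
      | zero => simp
      | add y y' hy hy' => simp only [map_add, mul_add, hy, hy', smul_add]; abel
      | tmul b' c' =>
        have h := hP b b'
        simp only [TensorProduct.map_tmul, LinearMap.id_apply,
          Algebra.TensorProduct.tmul_mul_tmul, map_add, map_smul] at h ⊢
        rw [h, TensorProduct.add_tmul, TensorProduct.add_tmul, TensorProduct.smul_tmul']
  | right =>
    intro x y
    induction x with
    | zero => simp
    | add x x' hx hx' => simp only [map_add, add_mul, hx, hx']; abel
    | tmul b c =>
      induction y with
      | zero => simp
      | add y y' hy hy' => simp only [map_add, mul_add, hy, hy']; abel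
      | tmul b' c' =>
        have h := hP b b'
        simp only [TensorProduct.map_tmul, LinearMap.id_apply,
          Algebra.TensorProduct.tmul_mul_tmul, map_add] at h ⊢
        rw [h, TensorProduct.sub_tmul, TensorProduct.add_tmul]
  | left =>
    intro x y
    induction x with
    | zero => simp
    | add x x' hx hx' => simp only [map_add, add_mul, hx, hx']; abel
    | tmul b c =>
      induction y with
      | zero => simp
      | add y y' hy hy' => simp only [map_add, mul_add, hy, hy']; abel
      | tmul b' c' =>
        have h := hP b b'
        simp only [TensorProduct.map_tmul, LinearMap.id_apply, Algebra.TensorProduct.one_def,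
          Algebra.TensorProduct.tmul_mul_tmul, map_add, mul_one] at h ⊢
        rw [h, TensorProduct.sub_tmul, TensorProduct.add_tmul]

theorem IsRHom.comp {X : B →ₗ[K] B} {Y : C →ₗ[K] C} {Z : D →ₗ[K] D} {g : C →ₐ[K] D}
    {f : B →ₐ[K] C} (hg : IsRHom Y Z g) (hf : IsRHom X Y f) : IsRHom X Z (g.comp f) :=
  fun x => by simp [hf x, hg (f x)]

theorem isRHom_id (X : B →ₗ[K] B) : IsRHom X X (AlgHom.id K B) := fun _ => rfl

/-- Phrased as an equality of linear maps so that extensionality on tensor products reduces it to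
pure tensors. -/
theorem isRHom_of_comp_eq {X : B →ₗ[K] B} {Y : C →ₗ[K] C} {f : B →ₐ[K] C}
    (h : f.toLinearMap ∘ₗ X = Y ∘ₗ f.toLinearMap) : IsRHom X Y f :=
  fun x => LinearMap.congr_fun h x

theorem IsRHom.map_id {X : B →ₗ[K] B} {Y : C →ₗ[K] C} {f : B →ₐ[K] C} (hf : IsRHom X Y f) :
    IsRHom (TensorProduct.map X (LinearMap.id : D →ₗ[K] D)) (TensorProduct.map Y LinearMap.id)
      (Algebra.TensorProduct.map f (AlgHom.id K D)) :=
  isRHom_of_comp_eq (TensorProduct.ext' fun x y => by simp [hf x])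

theorem isRHom_id_map (X : B →ₗ[K] B) (f : C →ₐ[K] D) :
    IsRHom (TensorProduct.map X LinearMap.id) (TensorProduct.map X LinearMap.id)
      (Algebra.TensorProduct.map (AlgHom.id K B) f) :=
  isRHom_of_comp_eq (TensorProduct.ext' fun x y => by simp)

/-- The operator acts on the leftmost factor only, so rebracketing does not affect it. -/
theorem isRHom_assoc (X : B →ₗ[K] B) :
    IsRHom (TensorProduct.map (TensorProduct.map X LinearMap.id) LinearMap.id)
      (TensorProduct.map X LinearMap.id) (Algebra.TensorProduct.assoc K K K B C D).toAlgHom :=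
  isRHom_of_comp_eq (TensorProduct.ext_threefold fun x y z => by simp)

/-- If `Δ` commutes with `P` and `P ⊗ id`, so does `(Δ ⊗ id) Δ`. -/
theorem IsRHom.coproduct_left {P : B →ₗ[K] B} {Δ : B →ₐ[K] B ⊗[K] B}
    (h : IsRHom P (tensorOp P) Δ) : IsRHom P (TensorProduct.map P LinearMap.id)
      (((Algebra.TensorProduct.assoc K K K B B B).toAlgHom.comp
        (Algebra.TensorProduct.map Δ (AlgHom.id K B))).comp Δ) :=
  ((isRHom_assoc P).comp h.map_id).comp h

/-- If `Δ` commutes with `P` and `P ⊗ id`, so does `(id ⊗ Δ) Δ`. -/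
theorem IsRHom.coproduct_right {P : B →ₗ[K] B} {Δ : B →ₐ[K] B ⊗[K] B}
    (h : IsRHom P (tensorOp P) Δ) : IsRHom P (TensorProduct.map P LinearMap.id)
      ((Algebra.TensorProduct.map (AlgHom.id K B) Δ).comp Δ) :=
  (isRHom_id_map P Δ).comp h

end Operators

/-! ### Freeness of the shuffle algebra -/

section Free

variable {K : Type*} [CommRing K] (q : Kind K) {A : Type*} [CommRing A] [Algebra K A]
  {B : Type*} [CommRing B] [Algebra K B]

/-- Induction on `T⁺(A)`. -/
theorem TPlus.induction {p : TPlus K q A → Prop} (zero : p 0)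
    (add : ∀ x y, p x → p y → p (x + y)) (tmul : ∀ a U, p (a ⊗ₜ Sh.of K q A U))
    (x : TPlus K q A) : p x :=
  TensorProduct.induction_on x zero (fun a U => tmul a ((Sh.of K q A).symm U)) add

/-- On pure tensors the product of two shifts is `1 ⊗` the product of two nonempty words, and
`shuffle_cons_cons` expands it into the terms of the operator identity. -/
theorem isROperator_rightShift : IsROperator q (rightShift K q A) := by
  cases q with
  | theta θ =>
    intro x y
    induction x using TPlus.induction with
    | zero => simp
    | add x x' hx hx' => simp only [map_add, add_mul, hx, hx', smul_add]; abel
    | tmul a U =>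
      induction y using TPlus.induction with
      | zero => simp
      | add y y' hy hy' => simp only [map_add, mul_add, hy, hy', smul_add]; abel
      | tmul b V =>
        simp only [rightShift_tmul, TPlus.tmul_mul_tmul, shuffle_cons_cons, map_add, map_smul,
          one_mul, mul_one, TensorProduct.tmul_add]
        simp [contr, cons]
        abel
  | right =>
    intro x y
    induction x using TPlus.induction with
    | zero => simp
    | add x x' hx hx' => simp only [map_add, add_mul, hx, hx']; abel
    | tmul a U =>
      induction y using TPlus.induction with
      | zero => simp
      | add y y' hy hy' => simp only [map_add, mul_add, hy, hy']; abel
      | tmul b V =>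
        simp only [rightShift_tmul, TPlus.tmul_mul_tmul, shuffle_cons_cons, map_add,
          one_mul, mul_one, TensorProduct.tmul_add]
        simp [contr, cons, mul_assoc, TensorProduct.tmul_neg]
        abel
  | left =>
    intro x y
    induction x using TPlus.induction with
    | zero => simp
    | add x x' hx hx' => simp only [map_add, add_mul, hx, hx']; abel
    | tmul a U =>
      induction y using TPlus.induction with
      | zero => simp
      | add y y' hy hy' => simp only [map_add, mul_add, hy, hy']; abel
      | tmul b V =>
        -- The element `P(1)` is the one-letter word `1_A`. Multiplying by that word prepends it
        -- (`shuffle_left_one_cons`), which turns `x P(1) y` into the contraction `ab ⊗ 1_A ⊗ (U •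
        -- V)`.
        have e : rightShift K .left A 1 = 1 ⊗ₜ Sh.of K .left A (cons K A 1 1) :=
          rightShift_tmul K .left A 1 1
        simp only [e, rightShift_tmul, TPlus.tmul_mul_tmul, shuffle_cons_cons, map_add,
          one_mul, mul_one, TensorProduct.tmul_add, shuffle_comm .left U (cons K A 1 1),
          shuffle_left_one_cons, shuffle_one_left]
        simp [contr, cons, mul_assoc, TensorProduct.tmul_neg]
        abel

/-- A left inverse is induced by the augmentation of `T(A)`, which kills words of positive length;
it is needed only as a linear map. -/
theorem incl_injective : Function.Injective (incl K q A) := by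
  let r : TPlus K q A →ₗ[K] A := (TensorProduct.rid K A).toLinearMap ∘ₗ
    TensorProduct.map LinearMap.id
      ((TensorAlgebra.algebraMapInv (R := K) (M := A)).toLinearMap ∘ₗ
        (Sh.of K q A).symm.toLinearMap)
  refine Function.LeftInverse.injective (g := r) fun a => ?_
  simp [r, incl, Sh.one_def]

/-- The linear extension of `φ` to words, `a ⊗ U ↦ X (φ a * wordLift U)`. -/
noncomputable def wordLift (X : B →ₗ[K] B) (φ : A →ₐ[K] B) : TensorAlgebra K A →ₗ[K] B :=
  (LinearMap.applyₗ (1 : B)).comp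
    (TensorAlgebra.lift K
      -- A letter `a` acts as the endomorphism `u ↦ X(φ(a) u)`; a word acts by composition and is
      -- evaluated at `1`.
      ((LinearMap.llcomp K B B B X).comp ((LinearMap.mul K B).comp φ.toLinearMap) :
        A →ₗ[K] Module.End K B)).toLinearMap

variable {X : B →ₗ[K] B} {φ : A →ₐ[K] B}

theorem wordLift_one : wordLift X φ 1 = 1 := by simp [wordLift]

theorem wordLift_cons (a : A) (U : TensorAlgebra K A) :
    wordLift X φ (cons K A a U) = X (φ a * wordLift X φ U) := by
  simp [wordLift, cons]

/-- The `TD` identity at `x = 1` collapses to `X(1) X(y) = X(X(y))`. A nonempty word has its value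
in the image of `X`, and the empty word has value `1`. -/
theorem op_one_mul_wordLift (hX : IsROperator .left X) (U : TensorAlgebra K A) :
    X 1 * wordLift X φ U = X (wordLift X φ U) := by
  induction U using word_induction with
  | one => simp [wordLift_one]
  | cons a U _ =>
    rw [wordLift_cons, hX]
    simp
  | add U V h h' => simp [mul_add, h, h']
  | smul k U h => simp [h]

variable {q}

/-- The operator identity at `x = φ(a) w(U)`, `y = φ(b) w(V)`, with its terms arranged as in
`shuffle_cons_cons`. -/
theorem wordLift_op_mul_op (hX : IsROperator q X) (a b : A) (U V : TensorAlgebra K A) :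
    X (φ a * wordLift X φ U) * X (φ b * wordLift X φ V) =
      X (φ a * (wordLift X φ U * X (φ b * wordLift X φ V))) +
      X (φ b * (X (φ a * wordLift X φ U) * wordLift X φ V)) +
      match q with
      | .theta θ => θ • X (φ (a * b) * (wordLift X φ U * wordLift X φ V))
      | .right => -X (X (φ (a * b) * (wordLift X φ U * wordLift X φ V)))
      | .left => -X (φ (a * b) * (X 1 * (wordLift X φ U * wordLift X φ V))) := by
  rw [map_mul φ a b]
  generalize φ a = s, φ b = t, wordLift X φ U = u, wordLift X φ V = v
  cases q with
  | theta θ =>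
    rw [hX, map_smul, map_add, add_comm (X (X (s * u) * _))]
    congr 3
    · ring
    · ring
    · ring_nf
  | right =>
    rw [hX, map_add, add_comm (X (X (s * u) * _)), sub_eq_add_neg]
    congr 3
    · ring
    · ring
    · ring_nf
  | left =>
    rw [hX, map_add, add_comm (X (X (s * u) * _)), sub_eq_add_neg]
    congr 3
    · ring
    · ring
    · ring_nf

/-- Evaluates the contraction term in the form that `wordLift_op_mul_op` produces; for this the `TD`
case trades `X(w(U))` for `X(1) w(U)`. -/
theorem wordLift_contr_mul (hX : IsROperator q X) (a b : A) (U : TensorAlgebra K A) :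
    wordLift X φ (contr q a b * U) =
      match q with
      | .theta θ => θ • X (φ (a * b) * wordLift X φ U)
      | .right => -X (X (φ (a * b) * wordLift X φ U))
      | .left => -X (φ (a * b) * (X 1 * wordLift X φ U)) := by
  cases q with
  | theta θ =>
    have e : contr (.theta θ) a b * U = θ • cons K A (a * b) U := by simp [contr, cons]
    rw [e, map_smul, wordLift_cons]
  | right =>
    have e : contr .right a b * U = -cons K A 1 (cons K A (a * b) U) := by
      simp [contr, cons, mul_assoc]
    rw [e, map_neg, wordLift_cons, wordLift_cons, map_one, one_mul]
  | left =>
    have e : contr .left a b * U = -cons K A (a * b) (cons K A 1 U) := by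
      simp [contr, cons, mul_assoc]
    rw [e, map_neg, wordLift_cons, wordLift_cons, map_one, one_mul, op_one_mul_wordLift hX]

/-- Double induction on words: each product on the right of the recursion involves a shorter word,
and what remains is the operator identity in `B`. -/
theorem wordLift_shuffle (hX : IsROperator q X) (U V : TensorAlgebra K A) :
    wordLift X φ (shuffle q U V) = wordLift X φ U * wordLift X φ V := by
  induction U using word_induction generalizing V with
  | one => simp [shuffle_one_left, wordLift_one]
  | cons a U hU =>
    induction V using word_induction with
    | one => simp [shuffle_one_right, wordLift_one]
    | cons b V hV =>
      rw [shuffle_cons_cons, map_add, map_add, wordLift_contr_mul hX, wordLift_cons,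
        wordLift_cons, hU, hU, hV, wordLift_cons, wordLift_cons, wordLift_op_mul_op hX]
    | add V V' h h' => simp [h, h', mul_add]
    | smul k V h => simp [h]
  | add U U' h h' => simp [h, h', add_mul]
  | smul k U h => simp [h]

/-- `wordLift` as a morphism of algebras `(T(A), •^q) → B`. -/
noncomputable def shLift (hX : IsROperator q X) (φ : A →ₐ[K] B) : Sh K q A →ₐ[K] B :=
  AlgHom.ofLinearMap (wordLift X φ ∘ₗ (Sh.of K q A).symm.toLinearMap)
    (by simp [Sh.one_def, wordLift_one])
    (fun U V => by simp [Sh.mul_def, wordLift_shuffle hX])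

/-- The R-algebra morphism `T⁺(A) → B` extending `φ : A → B`. -/
noncomputable def lift (hX : IsROperator q X) (φ : A →ₐ[K] B) : TPlus K q A →ₐ[K] B :=
  Algebra.TensorProduct.lift φ (shLift hX φ) (fun _ _ => Commute.all _ _)

theorem lift_tmul (hX : IsROperator q X) (a : A) (U : TensorAlgebra K A) :
    lift hX φ (a ⊗ₜ Sh.of K q A U) = φ a * wordLift X φ U := by
  simp [lift, shLift]

theorem lift_comp_incl (hX : IsROperator q X) : (lift hX φ).comp (incl K q A) = φ := by
  ext a
  simp [lift, incl]

theorem isRHom_lift (hX : IsROperator q X) : IsRHom (rightShift K q A) X (lift hX φ) := by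
  intro x
  induction x using TPlus.induction with
  | zero => simp
  | add x y hx hy => simp [hx, hy]
  | tmul a U =>
    rw [rightShift_tmul, lift_tmul, lift_tmul, wordLift_cons, map_one, one_mul]

/-- An R-algebra morphism on `T⁺(A)` is determined by its restriction to `A`. -/
theorem IsRHom.ext_incl {f g : TPlus K q A →ₐ[K] B} (hf : IsRHom (rightShift K q A) X f)
    (hg : IsRHom (rightShift K q A) X g) (h : f.comp (incl K q A) = g.comp (incl K q A)) :
    f = g := by
  have hi : ∀ a : A, f (a ⊗ₜ 1) = g (a ⊗ₜ 1) := fun a => DFunLike.congr_fun h a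
  have split : ∀ (a : A) (U : TensorAlgebra K A), (a ⊗ₜ Sh.of K q A U : TPlus K q A) =
      (a ⊗ₜ 1) * (1 ⊗ₜ Sh.of K q A U) := fun a U => by
    rw [Algebra.TensorProduct.tmul_mul_tmul, mul_one, one_mul]
  have hw : ∀ U : TensorAlgebra K A, f (1 ⊗ₜ Sh.of K q A U) = g (1 ⊗ₜ Sh.of K q A U) := by
    intro U
    induction U using word_induction with
    | one => exact hi 1
    | cons a U hU =>
      -- Both morphisms commute with the shift, which strips it off; the letter `a` then splits off
      -- as a factor from `A`, leaving the shorter word.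
      rw [← rightShift_tmul, hf, hg, split, map_mul f, map_mul g, hi, hU]
    | add U V hU hV => simp [TensorProduct.tmul_add, hU, hV]
    | smul k U hU => simp [hU]
  ext1
  · exact h
  · ext U
    exact hw ((Sh.of K q A).symm U)

end Free

/-- `(T⁺(A), P_A)` is the free commutative R-algebra over the commutative algebra `A`. -/
theorem isFree_rightShift.{uB, uK, uA} {K : Type uK} [CommRing K] (q : Kind K) (A : Type uA)
    [CommRing A] [Algebra K A] : IsFree.{uB} q (rightShift K q A) (incl K q A) where
  isROperator := isROperator_rightShift q
  injective := incl_injective q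
  existsUnique_lift _ _ _ _ hX _ :=
    ⟨lift hX _, ⟨isRHom_lift hX, lift_comp_incl hX⟩, fun _ hf =>
      hf.1.ext_incl (isRHom_lift hX) (hf.2.trans (lift_comp_incl hX).symm)⟩

/-! ### The right R-bialgebra structure over a bialgebra -/

section Bialgebra

variable {K : Type*} [CommRing K] (q : Kind K) (H : Type*) [CommRing H] [Bialgebra K H]

theorem isROperator_tensorOp_rightShift : IsROperator q (tensorOp (rightShift K q H)) :=
  (isROperator_rightShift q).map_id

/-- The coproduct of `T⁺(H)` extending that of `H`. -/
noncomputable def coproduct : TPlus K q H →ₐ[K] TPlus K q H ⊗[K] TPlus K q H :=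
  lift (isROperator_tensorOp_rightShift q H)
    ((Algebra.TensorProduct.map (incl K q H) (incl K q H)).comp (Bialgebra.comulAlgHom K H))

/-- The counit of `T⁺(H)` extending that of `H`. -/
noncomputable def counit : TPlus K q H →ₐ[K] K :=
  lift (isROperator_groundOp q) (Bialgebra.counitAlgHom K H)

theorem coproduct_comp_incl : (coproduct q H).comp (incl K q H) =
    (Algebra.TensorProduct.map (incl K q H) (incl K q H)).comp (Bialgebra.comulAlgHom K H) :=
  lift_comp_incl (isROperator_tensorOp_rightShift q H)

theorem counit_comp_incl :
    (counit q H).comp (incl K q H) = Bialgebra.counitAlgHom K H :=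
  lift_comp_incl _

theorem isRHom_coproduct :
    IsRHom (rightShift K q H) (tensorOp (rightShift K q H)) (coproduct q H) :=
  isRHom_lift _

theorem isRHom_counit : IsRHom (rightShift K q H) (groundOp q) (counit q H) :=
  isRHom_lift _

/-- Both sides are R-morphisms into the triple tensor power with `P` on the leftmost factor, so they
are compared on `H`, where coassociativity of `δ` is transported along `i ⊗ i ⊗ i`. -/
theorem coproduct_coassoc :
    ((Algebra.TensorProduct.assoc K K K (TPlus K q H) (TPlus K q H) (TPlus K q H)).toAlgHom.comp
      (Algebra.TensorProduct.map (coproduct q H) (AlgHom.id K _))).comp (coproduct q H) =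
    (Algebra.TensorProduct.map (AlgHom.id K _) (coproduct q H)).comp (coproduct q H) := by
  refine (isRHom_coproduct q H).coproduct_left.ext_incl
    (isRHom_coproduct q H).coproduct_right ?_
  have hi : ∀ a, coproduct q H (incl K q H a) =
      Algebra.TensorProduct.map (incl K q H) (incl K q H) (Coalgebra.comul (R := K) a) :=
    fun a => DFunLike.congr_fun (coproduct_comp_incl q H) a
  let i₃ := Algebra.TensorProduct.map (incl K q H)
    (Algebra.TensorProduct.map (incl K q H) (incl K q H))
  have hl : ∀ z : H ⊗[K] H,
      Algebra.TensorProduct.assoc K K K (TPlus K q H) (TPlus K q H) (TPlus K q H)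
        (Algebra.TensorProduct.map (coproduct q H) (AlgHom.id K _)
          (Algebra.TensorProduct.map (incl K q H) (incl K q H) z)) =
      i₃ (TensorProduct.assoc K H H H (Coalgebra.comul.rTensor H z)) := by
    intro z
    induction z with
    | zero => simp
    | add z z' h h' => simp only [map_add, h, h']
    | tmul a b =>
      simp only [Algebra.TensorProduct.map_tmul, hi, LinearMap.rTensor_tmul, AlgHom.id_apply]
      -- The claim is linear in `δ(a)`, so an arbitrary tensor may replace it.
      generalize (Coalgebra.comul a : H ⊗[K] H) = w
      induction w with
      | zero => simp
      | add z z' h h' => simp only [map_add, TensorProduct.add_tmul, h, h']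
      | tmul c d => simp [i₃]
  have hr : ∀ z : H ⊗[K] H,
      Algebra.TensorProduct.map (AlgHom.id K _) (coproduct q H)
        (Algebra.TensorProduct.map (incl K q H) (incl K q H) z) =
      i₃ (Coalgebra.comul.lTensor H z) := by
    intro z
    induction z with
    | zero => simp
    | add z z' h h' => simp only [map_add, h, h']
    | tmul a b => simp [hi, i₃]
  ext a
  simp only [AlgHom.comp_apply, hi, hr]
  rw [← Coalgebra.coassoc_apply, ← hl]
  rfl

/-- Composite and identity are both R-endomorphisms of `T⁺(H)`; on `H` they agree by the right
counit law of `H`. -/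
theorem coproduct_right_counit :
    ((Algebra.TensorProduct.rid K K (TPlus K q H)).toAlgHom.comp
      (Algebra.TensorProduct.map (AlgHom.id K _) (counit q H))).comp (coproduct q H) =
    AlgHom.id K _ := by
  refine IsRHom.ext_incl (X := rightShift K q H)
    (IsRHom.comp ?_ (isRHom_coproduct q H)) (isRHom_id _) ?_
  -- Linearity of `P` is all that is used here: `P(ε(y) x) = ε(y) P(x)`.
  · refine isRHom_of_comp_eq (TensorProduct.ext' fun x y => ?_)
    simp [tensorOp]
  · have hi : ∀ a, counit q H (incl K q H a) = Coalgebra.counit (R := K) a :=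
      fun a => DFunLike.congr_fun (counit_comp_incl q H) a
    have hr : ∀ z : H ⊗[K] H,
        Algebra.TensorProduct.rid K K (TPlus K q H)
          (Algebra.TensorProduct.map (AlgHom.id K _) (counit q H)
            (Algebra.TensorProduct.map (incl K q H) (incl K q H) z)) =
        incl K q H (TensorProduct.rid K H (Coalgebra.counit.lTensor H z)) := by
      intro z
      induction z with
      | zero => simp
      | add z z' h h' => simp only [map_add, h, h']
      | tmul a b => simp [hi]
    rw [AlgHom.comp_assoc, coproduct_comp_incl]
    ext a
    refine (hr (Coalgebra.comul a)).trans ?_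
    simp

theorem isRightRBialgebra_rightShift :
    IsRightRBialgebra q (rightShift K q H) (coproduct q H) (counit q H) where
  isROperator := isROperator_rightShift q
  isROperator_tensor := isROperator_tensorOp_rightShift q H
  isROperator_ground := isROperator_groundOp q
  isRHom_coproduct := isRHom_coproduct q H
  isRHom_counit := isRHom_counit q H
  coassoc := congrArg AlgHom.toLinearMap (coproduct_coassoc q H)
  right_counit := congrArg AlgHom.toLinearMap (coproduct_right_counit q H)

end Bialgebra

end RAlg

theorem mainTheorem5 {K : Type u} [Field K] [CharZero K]
    {H : Type v} [CommRing H] [Bialgebra K H] (q : RAlg.Kind K) :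
    RAlg.IsFree.{w} q (RAlg.rightShift K q H) (RAlg.incl K q H) ∧
    ∃ (Δ : RAlg.TPlus K q H →ₐ[K] RAlg.TPlus K q H ⊗[K] RAlg.TPlus K q H)
      (ε : RAlg.TPlus K q H →ₐ[K] K),
      RAlg.IsRightRBialgebra q (RAlg.rightShift K q H) Δ ε ∧
      Δ.comp (RAlg.incl K q H) =
        (Algebra.TensorProduct.map (RAlg.incl K q H) (RAlg.incl K q H)).comp
          (Bialgebra.comulAlgHom K H) ∧
      ε.comp (RAlg.incl K q H) = Bialgebra.counitAlgHom K H ∧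
      (∀ Δ' : RAlg.TPlus K q H →ₐ[K] RAlg.TPlus K q H ⊗[K] RAlg.TPlus K q H,
        RAlg.IsRHom (RAlg.rightShift K q H)
          (RAlg.tensorOp (RAlg.rightShift K q H)) Δ' →
        Δ'.comp (RAlg.incl K q H) =
          (Algebra.TensorProduct.map (RAlg.incl K q H) (RAlg.incl K q H)).comp
            (Bialgebra.comulAlgHom K H) → Δ' = Δ) ∧
      (∀ ε' : RAlg.TPlus K q H →ₐ[K] K,
        RAlg.IsRHom (RAlg.rightShift K q H) (RAlg.groundOp q) ε' →
        ε'.comp (RAlg.incl K q H) = Bialgebra.counitAlgHom K H → ε' = ε) := by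
  refine ⟨RAlg.isFree_rightShift q H, RAlg.coproduct q H, RAlg.counit q H,
    RAlg.isRightRBialgebra_rightShift q H, RAlg.coproduct_comp_incl q H,
    RAlg.counit_comp_incl q H, fun Δ h hi => ?_, fun ε h hi => ?_⟩
  -- Freeness as stated tests algebras in the universe `w` only; `IsRHom.ext_incl` applies to
  -- targets in any universe.
  · exact h.ext_incl (RAlg.isRHom_coproduct q H) (hi.trans (RAlg.coproduct_comp_incl q H).symm)
  · exact h.ext_incl (RAlg.isRHom_counit q H) (hi.trans (RAlg.counit_comp_incl q H).symm)
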